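/- Let $n\ge 1$, $\alpha\in[0,1]$, $0\le\mu\le\bar v$, and let $0\le v_1\le\dots\le v_n\le\bar v$ be fixed price levels; put $v_{n+1}=\bar v$. Assume that $\mu<\bar v$ or $v_n<\bar v$. Let $\mathcal F$ be the set of probability distributions $F$ on $[0,\bar v]$ with mean $\mu$, and write $F(p-)$ for the left limit at $p$ of the distribution function of $F$. For $\boldsymbol x\in\mathbb R_+^n$ with $\sum_{i=1}^n x_i=1$, let $\pi_{\boldsymbol x}=\sum_{i=1}^n x_i\delta_{v_i}$ be the mechanism that posts the price $v_i$ with probability $x_i$. A buyer with valuation $v$ pays $t_{\boldsymbol x}(v)=\int_{[0,v]}u\,\pi_{\boldsymbol x}(du)=\sum_{i:\,v_i\le v}v_ix_i$ in expectation. Let $$\mathsf{OBJ}_\alpha(\boldsymbol x)=\inf_{F\in\mathcal F}\ \inf_{p\in[0,\bar v]}\left(\int_{[0,\bar v]}t_{\boldsymbol x}(v)\,dF(v)-\alpha\,p\,(1-F(p-))\right),\qquad \mathsf{OBJ}_\alpha=\sup_{\boldsymbol x}\mathsf{OBJ}_\alpha(\boldsymbol x),$$ where the supremum is over all $\boldsymbol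 x\in\mathbb R_+^n$ with $\sum_i x_i=1$. Then $\mathsf{OBJ}_\alpha$ equals the optimal value of the finite linear program $$\begin{aligned}\sup_{\boldsymbol x\in\mathbb R_+^n,\ \boldsymbol\lambda\in\mathbb R^{n+1},\ \Delta\in\mathbb R}\ &\Delta\\ \text{s.t.}\quad &\Delta\le\sum_{l=1}^{j-1}v_lx_l-\lambda_i(v_j-\mu) && \forall\, i=1,\dots,n+1,\ j=1,\dots,i-1,\\ &\Delta\le\sum_{l=1}^{j-1}v_lx_l-\alpha v_i-\lambda_i(v_j-\mu) && \forall\, i=1,\dots,n+1,\ j=i,\dots,n+1,\\ &\Delta\le\lambda_i\mu && \forall\, i=1,\dots,n+1,\\ &\sum_{j=1}^n x_j=1.\end{aligned}$$ Moreover, a probability vector $\boldsymbol x$ satisfies $\mathsf{OBJ}_\alpha(\boldsymbol x)=\mathsf{OBJ}_\alpha$ if and only if it is the $\boldsymbol x$-part of some optimal solution $(\boldsymbol x,\boldsymbol\lambda,\Delta)$ of this linear program. -/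

import Mathlib

open MeasureTheory

namespace RobustPricing

noncomputable section

/-- The randomized pricing mechanism (price density) `π = ∑ i, x i • δ_(v i)`, as a measure on
the prices. -/
def priceMechanism {n : ℕ} (v x : Fin n → ℝ) : Measure ℝ :=
  ∑ i, ENNReal.ofReal (x i) • Measure.dirac (v i)

/-- The mechanisms that randomize over the given price levels `v 0, …, v (n - 1)` only. -/
def mechanismsAt {n : ℕ} (v : Fin n → ℝ) : Set (Measure ℝ) :=
  {π | ∃ x ∈ stdSimplex ℝ (Fin n), π = priceMechanism v x}

/-- The expected payment `t(w) = ∫_0^w π(u) u du` of a buyer with valuation `w`; the buyer accepts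
a price equal to the valuation. -/
def payment (π : Measure ℝ) (w : ℝ) : ℝ := ∫ u in Set.Icc 0 w, u ∂π

/-- The expected revenue of the mechanism `π` against the valuation distribution `F`. -/
def revenue (vbar : ℝ) (π F : Measure ℝ) : ℝ := ∫ w in Set.Icc 0 vbar, payment π w ∂F

/-- The revenue `p (1 - F(p-))` of the posted price `p`, where `F(p-)` is the left limit at `p`
of the cumulative distribution function. -/
def postedRevenue (F : Measure ℝ) (p : ℝ) : ℝ :=
  p * (1 - Function.leftLim (ProbabilityTheory.cdf F) p)

/-- The mean ambiguity set: probability measures on `[0, vbar]` with mean `μ`. -/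
def meanAmbiguitySet (vbar μ : ℝ) : Set (Measure ℝ) :=
  {F | IsProbabilityMeasure F ∧ F (Set.Icc 0 vbar)ᶜ = 0 ∧ ∫ w, w ∂F = μ}

/-- The worst case over `F` and `p` of the revenue of `π` minus `α` times the revenue
of the price `p` (the infimum over `p` brings in the clairvoyant revenue). -/
def objective (α vbar μ : ℝ) (π : Measure ℝ) : EReal :=
  ⨅ F ∈ meanAmbiguitySet vbar μ, ⨅ p ∈ Set.Icc 0 vbar,
    ((revenue vbar π F - α * postedRevenue F p : ℝ) : EReal)

/-- The optimal robust metric for the given price levels. -/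
def optimalObjective {n : ℕ} (α vbar μ : ℝ) (v : Fin n → ℝ) : EReal :=
  ⨆ π ∈ mechanismsAt v, objective α vbar μ π

/-- The price levels `v_1, …, v_n` followed by `v_(n+1) = vbar`. -/
def levels {n : ℕ} (vbar : ℝ) (v : Fin n → ℝ) : Fin (n + 1) → ℝ :=
  Fin.snoc (α := fun _ => ℝ) v vbar

/-- The partial sum `∑_{l < j} v_l x_l`. -/
def partialSum {n : ℕ} (v x : Fin n → ℝ) (j : Fin (n + 1)) : ℝ :=
  ∑ l : Fin n with l.castSucc < j, v l * x l

/-- The constraints of the finite linear program in the variables `x`, `lam`, `Δ`. -/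
structure IsLPFeasible {n : ℕ} (α vbar μ : ℝ) (v : Fin n → ℝ)
    (x : Fin n → ℝ) (lam : Fin (n + 1) → ℝ) (Δ : ℝ) : Prop where
  nonneg : ∀ i, 0 ≤ x i
  sum_eq_one : ∑ i, x i = 1
  below : ∀ i j : Fin (n + 1), j < i →
    Δ ≤ partialSum v x j - lam i * (levels vbar v j - μ)
  above : ∀ i j : Fin (n + 1), i ≤ j →
    Δ ≤ partialSum v x j - α * levels vbar v i - lam i * (levels vbar v j - μ)
  zero : ∀ i : Fin (n + 1), Δ ≤ lam i * μ

/-- The optimal value of the linear program, which maximizes `Δ`. -/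
def lpValue {n : ℕ} (α vbar μ : ℝ) (v : Fin n → ℝ) : EReal :=
  ⨆ (x : Fin n → ℝ) (lam : Fin (n + 1) → ℝ) (Δ : ℝ) (_ : IsLPFeasible α vbar μ v x lam Δ),
    (Δ : EReal)

/-- `(x, lam, Δ)` is an optimal solution of the linear program. -/
def IsLPOptimal {n : ℕ} (α vbar μ : ℝ) (v : Fin n → ℝ)
    (x : Fin n → ℝ) (lam : Fin (n + 1) → ℝ) (Δ : ℝ) : Prop :=
  IsLPFeasible α vbar μ v x lam Δ ∧
    ∀ x' lam' Δ', IsLPFeasible α vbar μ v x' lam' Δ' → Δ' ≤ Δ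

end

end RobustPricing

/-! ### Payments and posted revenue as integrals -/

namespace RobustPricing

/-! The core is an equivalence for a fixed probability vector `x`: `Δ` is at most the objective of
`x` exactly when some `lam` makes `(x, lam, Δ)` feasible (`exists_isLPFeasible_iff`). It is duality
for the mean constraint: for each competing price, `lam i` is the slope of a line through `(μ, Δ)`
below the regret-adjusted revenue as a function of the valuation.

Feasibility bounds the objective because that revenue is a step function, so a line lies below it
once it does so at zero and at the left limits at the levels. A price `p` uses the line of the first
level at or above `p` (`IsLPFeasible.le_payment_sub`); integrating against `F` leaves `Δ`, since `F`
has mean `μ`.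

Conversely, two-point distributions with atoms and price just below the levels show that `(μ, Δ)`
lies below every segment joining constrained points on either side of `μ`
(`segment_le_of_le_objective`). In the plane this already yields a line (`exists_slope`). -/

theorem payment_priceMechanism {n : ℕ} {v x : Fin n → ℝ} (hv : ∀ i, 0 ≤ v i) (hx : ∀ i, 0 ≤ x i)
    (w : ℝ) : payment (priceMechanism v x) w = ∑ i with v i ≤ w, v i * x i := by
  unfold payment priceMechanism
  rw [← integral_indicator measurableSet_Icc, integral_finsetSum_measure]
  · rw [Finset.sum_filter]
    refine Finset.sum_congr rfl fun i _ => ?_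
    rw [integral_smul_measure, integral_dirac, ENNReal.toReal_ofReal (hx i)]
    by_cases h : v i ≤ w
    · simp [h, hv i, mul_comm]
    · simp [h]
  · intro i _
    refine Integrable.smul_measure ?_ ENNReal.ofReal_ne_top
    exact integrable_dirac (by simp [enorm_lt_top])

theorem postedRevenue_eq (F : Measure ℝ) [IsProbabilityMeasure F] (p : ℝ) :
    postedRevenue F p = ∫ w, (Set.Ici p).indicator (fun _ => p) w ∂F := by
  have h := (ProbabilityTheory.cdf F).measure_Ici (ProbabilityTheory.tendsto_cdf_atTop F) p
  rw [ProbabilityTheory.measure_cdf] at h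
  have h0 : 0 ≤ 1 - Function.leftLim (ProbabilityTheory.cdf F) p :=
    sub_nonneg.2 ((ProbabilityTheory.monotone_cdf F).leftLim_le le_rfl |>.trans
      (ProbabilityTheory.cdf_le_one F p))
  rw [integral_indicator_const _ measurableSet_Ici, Measure.real, h, ENNReal.toReal_ofReal h0,
    smul_eq_mul, mul_comm, postedRevenue]

theorem revenue_eq_integral {vbar : ℝ} {F : Measure ℝ} (h : F (Set.Icc 0 vbar)ᶜ = 0)
    (π : Measure ℝ) : revenue vbar π F = ∫ w, payment π w ∂F := by
  rw [revenue, Measure.restrict_eq_self_of_ae_mem]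
  exact mem_ae_iff.2 h

/-! ### Separation in the plane -/

/-- A real number that separates two finite families of real numbers. -/
theorem exists_between_families {ι : Type*} [Finite ι] (A B : ι → Prop) (l u : ι → ℝ)
    (h : ∀ a b, A a → B b → l a ≤ u b) :
    ∃ c, (∀ a, A a → l a ≤ c) ∧ ∀ b, B b → c ≤ u b := by
  have hl : BddAbove (l '' {a | A a}) := (Set.toFinite _).bddAbove
  have hu : BddBelow (u '' {b | B b}) := (Set.toFinite _).bddBelow
  by_cases hA : ∃ a, A a
  · obtain ⟨a₀, ha₀⟩ := hA
    exact ⟨sSup (l '' {a | A a}), fun a ha => le_csSup hl ⟨a, ha, rfl⟩, fun b hb =>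
      csSup_le ⟨_, a₀, ha₀, rfl⟩ (by rintro _ ⟨a, ha, rfl⟩; exact h a b ha hb)⟩
  -- Without lower bounds the infimum of the upper ones works; if these are absent too, any number
  -- does.
  · exact ⟨sInf (u '' {b | B b}), fun a ha => (hA ⟨a, ha⟩).elim,
      fun b hb => csInf_le hu ⟨b, hb, rfl⟩⟩

/-- Some line through `(m, d)` lies below all points `(y a, c a)`, provided that `(m, d)` lies
below every segment between two of the points. -/
theorem exists_slope {ι : Type*} [Finite ι] (y c : ι → ℝ) (m d : ℝ)
    (hm : ∀ a, y a = m → d ≤ c a)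
    (h : ∀ a b, y a < m → m < y b → d * (y b - y a) ≤ (y b - m) * c a + (m - y a) * c b) :
    ∃ s : ℝ, ∀ a, d ≤ c a - s * (y a - m) := by
  obtain ⟨s, hs₁, hs₂⟩ := exists_between_families (fun a => y a < m) (fun b => m < y b)
    (fun a => (d - c a) / (m - y a)) (fun b => (c b - d) / (y b - m)) (fun a b ha hb => by
      rw [div_le_div_iff₀ (sub_pos.2 ha) (sub_pos.2 hb)]
      nlinarith [h a b ha hb])
  refine ⟨s, fun a => ?_⟩
  rcases lt_trichotomy (y a) m with ha | ha | ha
  · have := (div_le_iff₀ (sub_pos.2 ha)).1 (hs₁ a ha)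
    linarith
  · simpa [ha] using hm a ha
  · have := (le_div_iff₀ (sub_pos.2 ha)).1 (hs₂ a ha)
    linarith

/-! ### Price levels and the payment step function -/

section Levels

variable {n : ℕ} {vbar : ℝ} {v x : Fin n → ℝ}

theorem levels_castSucc (i : Fin n) : levels vbar v i.castSucc = v i := by
  simp [levels]

theorem levels_last : levels vbar v (Fin.last n) = vbar := by
  simp [levels]

theorem levels_mem (hbar : 0 ≤ vbar) (hv : ∀ i, v i ∈ Set.Icc 0 vbar) (i : Fin (n + 1)) :
    levels vbar v i ∈ Set.Icc 0 vbar := by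
  induction i using Fin.lastCases with
  | last => rw [levels_last]; exact ⟨hbar, le_rfl⟩
  | cast i => rw [levels_castSucc]; exact hv i

theorem levels_monotone (hmono : Monotone v) (hv : ∀ i, v i ≤ vbar) :
    Monotone (levels vbar v) := by
  intro i j hij
  induction j using Fin.lastCases with
  | last =>
    rw [levels_last]
    induction i using Fin.lastCases with
    | last => rw [levels_last]
    | cast i => rw [levels_castSucc]; exact hv i
  | cast j =>
    induction i using Fin.lastCases with
    | last => exact absurd hij (not_le.2 (Fin.castSucc_lt_last j))
    | cast i => rw [levels_castSucc, levels_castSucc]; exact hmono (by simpa using hij)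

theorem partialSum_nonneg (hv : ∀ i, 0 ≤ v i) (hx : ∀ i, 0 ≤ x i) (j : Fin (n + 1)) :
    0 ≤ partialSum v x j :=
  Finset.sum_nonneg fun i _ => mul_nonneg (hv i) (hx i)

/-- The payment at a valuation below a level, or at valuation zero. -/
theorem payment_le_partialSum (hmono : Monotone v) (hv : ∀ i, v i ∈ Set.Icc 0 vbar)
    (hx : ∀ i, 0 ≤ x i) {w : ℝ} {j : Fin (n + 1)} (hw : w < levels vbar v j ∨ w = 0) :
    payment (priceMechanism v x) w ≤ partialSum v x j := by
  rw [payment_priceMechanism (fun i => (hv i).1) hx]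
  rcases hw with hw | rfl
  · refine Finset.sum_le_sum_of_subset_of_nonneg (fun l hl => ?_)
      fun i _ _ => mul_nonneg (hv i).1 (hx i)
    simp only [Finset.mem_filter, Finset.mem_univ, true_and] at hl ⊢
    by_contra hlj
    have := levels_monotone hmono (fun i => (hv i).2) (not_lt.1 hlj)
    rw [levels_castSucc] at this
    linarith
  -- At valuation zero only zero prices are accepted, and these pay nothing.
  · refine (Finset.sum_nonpos fun i hi => ?_).trans (partialSum_nonneg (fun i => (hv i).1) hx j)
    simp only [Finset.mem_filter, Finset.mem_univ, true_and] at hi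
    rw [le_antisymm hi (hv i).1, zero_mul]

/-- The payment at a valuation `w` is the partial sum up to the first level above `w`. -/
theorem exists_payment_eq (hmono : Monotone v) (hv : ∀ i, v i ∈ Set.Icc 0 vbar)
    (hx : ∀ i, 0 ≤ x i) {w : ℝ} (hw : w ≤ vbar) :
    ∃ j : Fin (n + 1), payment (priceMechanism v x) w = partialSum v x j ∧
      w ≤ levels vbar v j ∧ ∀ l < j, levels vbar v l ≤ w := by
  rw [payment_priceMechanism (fun i => (hv i).1) hx]
  have hL := levels_monotone (vbar := vbar) hmono (fun i => (hv i).2)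
  -- The inequality is strict because a price equal to the valuation is accepted. If no level
  -- exceeds `w`, every price is accepted and the last index carries the full sum.
  by_cases h : ∃ j, w < levels vbar v j
  · classical
    obtain ⟨j, hj, hmin⟩ := (Finset.univ.filter fun j => w < levels vbar v j).exists_minimal
      (by obtain ⟨j, hj⟩ := h; exact ⟨j, by simpa using hj⟩)
    simp only [Finset.mem_filter, Finset.mem_univ, true_and] at hj hmin
    have hlt : ∀ l < j, levels vbar v l ≤ w := fun l hl => by
      by_contra hc
      exact absurd (hmin (not_le.1 hc) hl.le) (not_le.2 hl)
    refine ⟨j, ?_, hj.le, hlt⟩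
    unfold partialSum
    congr 1
    ext l
    simp only [Finset.mem_filter, Finset.mem_univ, true_and]
    constructor
    · intro hl
      by_contra hc
      have := hL (not_lt.1 hc)
      rw [levels_castSucc] at this
      linarith
    · intro hl
      simpa [levels_castSucc] using hlt _ hl
  · push Not at h
    refine ⟨Fin.last n, ?_, by rwa [levels_last], fun l _ => h l⟩
    unfold partialSum
    congr 1
    ext l
    simpa [Fin.castSucc_lt_last, levels_castSucc] using h l.castSucc

theorem exists_first_level (p : ℝ) (hp : p ≤ vbar) :
    ∃ i : Fin (n + 1), p ≤ levels vbar v i ∧ ∀ l < i, levels vbar v l < p := by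
  classical
  obtain ⟨i, hi, hmin⟩ := (Finset.univ.filter fun i => p ≤ levels vbar v i).exists_minimal
    ⟨Fin.last n, by simpa [levels_last] using hp⟩
  simp only [Finset.mem_filter, Finset.mem_univ, true_and] at hi hmin
  refine ⟨i, hi, fun l hl => ?_⟩
  by_contra hc
  exact absurd (hmin (not_lt.1 hc) hl.le) (not_le.2 hl)

theorem measurable_payment (hv : ∀ i, 0 ≤ v i) (hx : ∀ i, 0 ≤ x i) :
    Measurable (payment (priceMechanism v x)) := by
  refine Monotone.measurable fun a b hab => ?_
  rw [payment_priceMechanism hv hx, payment_priceMechanism hv hx]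
  refine Finset.sum_le_sum_of_subset_of_nonneg (fun l hl => ?_)
    fun i _ _ => mul_nonneg (hv i) (hx i)
  simp only [Finset.mem_filter, Finset.mem_univ, true_and] at hl ⊢
  exact hl.trans hab

theorem integrable_payment (hv : ∀ i, 0 ≤ v i) (hx : ∀ i, 0 ≤ x i) (F : Measure ℝ)
    [IsFiniteMeasure F] : Integrable (payment (priceMechanism v x)) F := by
  refine Integrable.of_bound (measurable_payment hv hx).aestronglyMeasurable
    (∑ i, v i * x i) (Filter.Eventually.of_forall fun w => ?_)
  rw [payment_priceMechanism hv hx, Real.norm_of_nonneg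
    (Finset.sum_nonneg fun i _ => mul_nonneg (hv i) (hx i))]
  exact Finset.sum_le_sum_of_subset_of_nonneg (Finset.subset_univ _)
    fun i _ _ => mul_nonneg (hv i) (hx i)

theorem revenue_sub_postedRevenue (hv : ∀ i, 0 ≤ v i) (hx : ∀ i, 0 ≤ x i) {F : Measure ℝ}
    [IsProbabilityMeasure F] (hF : F (Set.Icc 0 vbar)ᶜ = 0) (α p : ℝ) :
    revenue vbar (priceMechanism v x) F - α * postedRevenue F p =
      ∫ w, (payment (priceMechanism v x) w - α * (Set.Ici p).indicator (fun _ => p) w) ∂F := by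
  rw [revenue_eq_integral hF, postedRevenue_eq, ← integral_const_mul, integral_sub]
  · exact integrable_payment hv hx F
  · exact ((integrable_const p).indicator measurableSet_Ici).const_mul α

/-! ### Weak duality: feasible points bound the objective -/

/-- The supporting line given by the multiplier of the first level above `p`. -/
theorem IsLPFeasible.le_payment_sub {α μ Δ : ℝ} {lam : Fin (n + 1) → ℝ}
    (h : IsLPFeasible α vbar μ v x lam Δ) (hα : 0 ≤ α) (hmono : Monotone v)
    (hv : ∀ i, v i ∈ Set.Icc 0 vbar) {p w : ℝ} (hp : 0 ≤ p) (hw : w ∈ Set.Icc 0 vbar)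
    {i : Fin (n + 1)} (hi : p ≤ levels vbar v i) (hi' : ∀ l < i, levels vbar v l < p) :
    Δ + lam i * (w - μ) ≤
      payment (priceMechanism v x) w - α * (Set.Ici p).indicator (fun _ => p) w := by
  obtain ⟨j, hj, hwj, hjw⟩ := exists_payment_eq (x := x) hmono hv h.nonneg hw.2
  have hL := levels_monotone (vbar := vbar) hmono (fun i => (hv i).2)
  have hP := fun j => partialSum_nonneg (x := x) (fun i => (hv i).1) h.nonneg j
  have hz := h.zero i
  have hb := h.below i j
  have ha := h.above i j
  have hpi : α * p ≤ α * levels vbar v i := mul_le_mul_of_nonneg_left hi hα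
  have hp0 : 0 ≤ α * p := mul_nonneg hα hp
  rw [hj]
  have hPj := hP j
  by_cases hpw : p ≤ w
  · rw [Set.indicator_of_mem (by exact hpw)]
    have hij : i ≤ j := by
      by_contra hc
      linarith [hi' j (not_le.1 hc)]
    have ha := ha hij
    have hPij : partialSum v x i ≤ partialSum v x j := by
      refine Finset.sum_le_sum_of_subset_of_nonneg (fun l hl => ?_)
        fun i _ _ => mul_nonneg (hv i).1 (h.nonneg i)
      simp only [Finset.mem_filter, Finset.mem_univ, true_and] at hl ⊢
      exact hl.trans_le hij
    -- An increasing line is tested at the next level `j`. A decreasing one is largest at `p`; there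
    -- `(α + lam i) * p` is compared with its value at level `i` or at zero, according to the sign
    -- of `α + lam i`.
    rcases le_total 0 (lam i) with hl | hl
    · nlinarith [mul_le_mul_of_nonneg_left hwj hl]
    · have hai := h.above i i le_rfl
      have h1 : lam i * w ≤ lam i * p := mul_le_mul_of_nonpos_left hpw hl
      rcases le_total 0 (α + lam i) with hs | hs
      · nlinarith [mul_le_mul_of_nonneg_left hi hs]
      · nlinarith [mul_nonpos_of_nonpos_of_nonneg hs hp]
  · rw [Set.indicator_of_notMem (by exact hpw), mul_zero, sub_zero]
    have hji : j ≤ i := by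
      by_contra hc
      linarith [hjw i (not_le.1 hc)]
    -- For negative slope the line is largest at zero, where the constraint `zero` makes it
    -- nonpositive.
    rcases le_total 0 (lam i) with hl | hl
    · have h1 := mul_le_mul_of_nonneg_left hwj hl
      rcases hji.lt_or_eq with hlt | rfl
      · nlinarith [hb hlt]
      · nlinarith [ha le_rfl]
    · nlinarith [mul_nonpos_of_nonpos_of_nonneg hl hw.1]

theorem IsLPFeasible.le_objective {α μ Δ : ℝ} {lam : Fin (n + 1) → ℝ}
    (h : IsLPFeasible α vbar μ v x lam Δ) (hα : 0 ≤ α) (hmono : Monotone v)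
    (hv : ∀ i, v i ∈ Set.Icc 0 vbar) :
    (Δ : EReal) ≤ objective α vbar μ (priceMechanism v x) := by
  refine le_iInf₂ fun F hF => le_iInf₂ fun p hp => ?_
  obtain ⟨hprob, hsupp, hmean⟩ := hF
  rw [EReal.coe_le_coe_iff, revenue_sub_postedRevenue (fun i => (hv i).1) h.nonneg hsupp]
  obtain ⟨i, hi, hi'⟩ := exists_first_level (v := v) p hp.2
  have hae : ∀ᵐ w ∂F, w ∈ Set.Icc 0 vbar := mem_ae_iff.2 hsupp
  have hid : Integrable (fun w : ℝ => w) F :=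
    Integrable.of_bound measurable_id.aestronglyMeasurable vbar
      (hae.mono fun w hw => by rw [Real.norm_of_nonneg hw.1]; exact hw.2)
  have hsub : Integrable (fun w : ℝ => w - μ) F := hid.sub (integrable_const μ)
  have hline : ∫ w, (Δ + lam i * (w - μ)) ∂F = Δ := by
    rw [integral_add (integrable_const _) (hsub.const_mul _), integral_const_mul,
      integral_sub hid (integrable_const _), hmean]
    simp
  rw [← hline]
  refine integral_mono_ae ((integrable_const _).add (hsub.const_mul _))
    ((integrable_payment (fun i => (hv i).1) h.nonneg F).sub
      (((integrable_const p).indicator measurableSet_Ici).const_mul α)) (hae.mono fun w hw => ?_)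
  exact h.le_payment_sub hα hmono hv hp.1 hw hi hi'

/-! ### Two-point distributions -/

theorem integral_two_point {a b s : ℝ} (hs : s ∈ Set.Icc (0 : ℝ) 1) (f : ℝ → ℝ) :
    ∫ w, f w ∂(ENNReal.ofReal s • Measure.dirac a + ENNReal.ofReal (1 - s) • Measure.dirac b) =
      s * f a + (1 - s) * f b := by
  rw [integral_add_measure, integral_smul_measure, integral_smul_measure, integral_dirac,
    integral_dirac, ENNReal.toReal_ofReal hs.1, ENNReal.toReal_ofReal (sub_nonneg.2 hs.2)]
  · rfl
  all_goals exact (integrable_dirac (by simp [enorm_lt_top])).smul_measure ENNReal.ofReal_ne_top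

/-- The bound on the objective that comes from a distribution on two points. -/
theorem le_two_point_of_le_objective {α μ Δ : ℝ} (hv : ∀ i, 0 ≤ v i) (hx : ∀ i, 0 ≤ x i)
    (h : (Δ : EReal) ≤ objective α vbar μ (priceMechanism v x)) {a b p s : ℝ}
    (ha : a ∈ Set.Icc 0 vbar) (hb : b ∈ Set.Icc 0 vbar) (hs : s ∈ Set.Icc (0 : ℝ) 1)
    (hmean : s * a + (1 - s) * b = μ) (hp : p ∈ Set.Icc 0 vbar) :
    Δ ≤ s * (payment (priceMechanism v x) a - α * (Set.Ici p).indicator (fun _ => p) a) +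
      (1 - s) * (payment (priceMechanism v x) b - α * (Set.Ici p).indicator (fun _ => p) b) := by
  set F := ENNReal.ofReal s • Measure.dirac a + ENNReal.ofReal (1 - s) • Measure.dirac b with hF
  have hprob : IsProbabilityMeasure F := ⟨by
    simp [hF, ← ENNReal.ofReal_add hs.1 (sub_nonneg.2 hs.2)]⟩
  have hsupp : F (Set.Icc 0 vbar)ᶜ = 0 := by
    simp [hF, ha.1, ha.2, hb.1, hb.2]
  have hmem : F ∈ meanAmbiguitySet vbar μ := ⟨hprob, hsupp, by
    rw [integral_two_point hs (fun w => w), hmean]⟩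
  have h1 := (h.trans (iInf₂_le F hmem)).trans (iInf₂_le p hp)
  rwa [EReal.coe_le_coe_iff, revenue_sub_postedRevenue hv hx hsupp, integral_two_point hs] at h1

end Levels
end RobustPricing

namespace RobustPricing

/-! ### Strong duality: slopes from two-point distributions -/

section Dual

variable {n : ℕ} {vbar : ℝ} {v x : Fin n → ℝ}

/-- The constrained points of the valuation axis: zero and the price levels. -/
def supportPoint (vbar : ℝ) (v : Fin n → ℝ) (a : Option (Fin (n + 1))) : ℝ :=
  a.elim 0 (levels vbar v)

/-- The regret-adjusted revenue at a support point (from the left) if the competing price is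
level `i` (from the left). -/
def supportValue (α vbar : ℝ) (v x : Fin n → ℝ) (i : Fin (n + 1))
    (a : Option (Fin (n + 1))) : ℝ :=
  a.elim 0 fun j => partialSum v x j - if i ≤ j then α * levels vbar v i else 0

theorem supportPoint_mem (hbar : 0 ≤ vbar) (hv : ∀ i, v i ∈ Set.Icc 0 vbar)
    (a : Option (Fin (n + 1))) : supportPoint vbar v a ∈ Set.Icc 0 vbar := by
  cases a with
  | none => exact ⟨le_rfl, hbar⟩
  | some j => exact levels_mem hbar hv j

theorem isLPFeasible_iff {α μ Δ : ℝ} {lam : Fin (n + 1) → ℝ} (hx : x ∈ stdSimplex ℝ (Fin n)) :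
    IsLPFeasible α vbar μ v x lam Δ ↔ ∀ i a,
      Δ ≤ supportValue α vbar v x i a - lam i * (supportPoint vbar v a - μ) := by
  constructor
  · intro h i a
    cases a with
    | none => simpa [supportValue, supportPoint] using h.zero i
    | some j =>
      by_cases hij : i ≤ j
      · simpa [supportValue, supportPoint, hij] using h.above i j hij
      · simpa [supportValue, supportPoint, hij] using h.below i j (not_le.1 hij)
  · intro h
    refine ⟨hx.1, hx.2, fun i j hij => ?_, fun i j hij => ?_, fun i => ?_⟩
    · simpa [supportValue, supportPoint, not_le.2 hij] using h i (some j)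
    · simpa [supportValue, supportPoint, hij] using h i (some j)
    · simpa [supportValue, supportPoint] using h i none

/-- Moving valuation and price down by the same `ε` keeps sales at the competing price while
avoiding the payment jump at the level. The only loss is `α * ε`, from the lower competing price;
clamping at zero keeps both admissible. -/
theorem payment_sub_le_supportValue {α : ℝ} (hα : 0 ≤ α) (hmono : Monotone v)
    (hv : ∀ i, v i ∈ Set.Icc 0 vbar) (hx : ∀ i, 0 ≤ x i) {ε : ℝ} (hε : 0 < ε) (i : Fin (n + 1))
    (a : Option (Fin (n + 1))) :
    payment (priceMechanism v x) (max 0 (supportPoint vbar v a - ε)) -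
      α * (Set.Ici (max 0 (levels vbar v i - ε))).indicator
        (fun _ => max 0 (levels vbar v i - ε)) (max 0 (supportPoint vbar v a - ε)) ≤
      supportValue α vbar v x i a + α * ε := by
  have hαε := mul_nonneg hα hε.le
  have hind : ∀ w, 0 ≤ α * (Set.Ici (max 0 (levels vbar v i - ε))).indicator
      (fun _ => max 0 (levels vbar v i - ε)) w := fun w =>
    mul_nonneg hα (Set.indicator_nonneg (fun _ _ => le_max_left _ _) _)
  cases a with
  | none =>
    have h0 : payment (priceMechanism v x) 0 ≤ 0 := by
      have := payment_le_partialSum (j := 0) hmono hv hx (Or.inr (rfl : (0 : ℝ) = 0))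
      simpa [partialSum] using this
    have hw : max 0 (supportPoint vbar v none - ε) = 0 :=
      max_eq_left (by simp [supportPoint, hε.le])
    have := hind 0
    rw [hw]
    simp only [supportValue, Option.elim_none]
    linarith
  | some j =>
    have hpay : payment (priceMechanism v x) (max 0 (levels vbar v j - ε)) ≤
        partialSum v x j := by
      refine payment_le_partialSum hmono hv hx ?_
      rcases max_cases 0 (levels vbar v j - ε) with h | h
      · exact Or.inr h.1
      · left; linarith [h.1]
    simp only [supportValue, supportPoint, Option.elim_some]
    split_ifs with hij
    · have hL := levels_monotone (vbar := vbar) hmono (fun i => (hv i).2) hij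
      rw [Set.indicator_of_mem
        (by exact max_le_max le_rfl (sub_le_sub_right hL ε))]
      have := mul_le_mul_of_nonneg_left (le_max_right 0 (levels vbar v i - ε)) hα
      linarith
    · linarith [hind (max 0 (levels vbar v j - ε))]

/-- The support values are left limits and need not be attained, so the two-point bound is applied
to atoms shifted by `ε`, and then `ε` tends to zero from the right. -/
theorem segment_le_of_le_objective {α μ Δ : ℝ} (hα : 0 ≤ α) (hμ : μ ∈ Set.Icc 0 vbar)
    (hmono : Monotone v) (hv : ∀ i, v i ∈ Set.Icc 0 vbar) (hx : ∀ i, 0 ≤ x i)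
    (h : (Δ : EReal) ≤ objective α vbar μ (priceMechanism v x)) (i : Fin (n + 1))
    {a b : Option (Fin (n + 1))} (ha : supportPoint vbar v a ≤ μ)
    (hb : μ < supportPoint vbar v b) :
    Δ * (supportPoint vbar v b - supportPoint vbar v a) ≤
      (supportPoint vbar v b - μ) * supportValue α vbar v x i a +
        (μ - supportPoint vbar v a) * supportValue α vbar v x i b := by
  have hbar := hμ.1.trans hμ.2
  have hya := supportPoint_mem hbar hv a
  have hyb := supportPoint_mem hbar hv b
  have hLi := levels_mem hbar hv i
  have key : ∀ ε > 0, ε < supportPoint vbar v b - μ →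
      Δ * (max 0 (supportPoint vbar v b - ε) - max 0 (supportPoint vbar v a - ε)) ≤
      (max 0 (supportPoint vbar v b - ε) - μ) * (supportValue α vbar v x i a + α * ε) +
      (μ - max 0 (supportPoint vbar v a - ε)) * (supportValue α vbar v x i b + α * ε) := by
    intro ε hε hεb
    have hca := payment_sub_le_supportValue hα hmono hv hx hε i a
    have hcb := payment_sub_le_supportValue hα hmono hv hx hε i b
    have hmax : ∀ {y : ℝ}, y ∈ Set.Icc 0 vbar → max 0 (y - ε) ∈ Set.Icc 0 vbar := fun hy =>
      ⟨le_max_left _ _, max_le hbar (by linarith [hy.2])⟩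
    have hA := hmax hya
    have hB := hmax hyb
    have hAμ : max 0 (supportPoint vbar v a - ε) ≤ μ := max_le hμ.1 (by linarith)
    have hBμ : μ < max 0 (supportPoint vbar v b - ε) := lt_max_of_lt_right (by linarith)
    generalize max 0 (supportPoint vbar v a - ε) = A at *
    generalize max 0 (supportPoint vbar v b - ε) = B at *
    have hAB : 0 < B - A := by linarith
    -- The weight on `A` that gives mean `μ`.
    have hs : (B - μ) / (B - A) ∈ Set.Icc (0 : ℝ) 1 :=
      ⟨div_nonneg (by linarith) hAB.le, (div_le_one hAB).2 (by linarith)⟩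
    have h1s : 1 - (B - μ) / (B - A) = (μ - A) / (B - A) := by field_simp; ring
    have hd := le_two_point_of_le_objective (fun i => (hv i).1) hx h hA hB hs
      (by rw [h1s]; field_simp; ring) (hmax hLi)
    rw [h1s] at hd
    have hd' := hd.trans (add_le_add (mul_le_mul_of_nonneg_left hca hs.1)
      (mul_le_mul_of_nonneg_left hcb (div_nonneg (by linarith) hAB.le)))
    rw [div_mul_eq_mul_div, div_mul_eq_mul_div, ← add_div] at hd'
    exact (le_div_iff₀ hAB).1 hd'
  have hev : ∀ᶠ ε in nhdsWithin (0 : ℝ) (Set.Ioi 0),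
      ε ∈ Set.Ioo 0 (supportPoint vbar v b - μ) :=
    Ioo_mem_nhdsGT (sub_pos.2 hb)
  have hlim := le_of_tendsto_of_tendsto
    (f := fun ε => Δ * (max 0 (supportPoint vbar v b - ε) - max 0 (supportPoint vbar v a - ε)))
    (g := fun ε =>
      (max 0 (supportPoint vbar v b - ε) - μ) * (supportValue α vbar v x i a + α * ε) +
      (μ - max 0 (supportPoint vbar v a - ε)) * (supportValue α vbar v x i b + α * ε))
    ((Continuous.tendsto (by fun_prop) 0).mono_left nhdsWithin_le_nhds)
    ((Continuous.tendsto (by fun_prop) 0).mono_left nhdsWithin_le_nhds)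
    (hev.mono fun ε hε => key ε hε.1 hε.2)
  simpa [hya.1, hyb.1] using hlim

theorem exists_isLPFeasible_of_le_objective {α μ Δ : ℝ} (hn : 0 < n) (hα : 0 ≤ α)
    (hμ : μ ∈ Set.Icc 0 vbar) (hmono : Monotone v) (hv : ∀ i, v i ∈ Set.Icc 0 vbar)
    (hdeg : μ < vbar ∨ ∀ i, v i < vbar) (hx : x ∈ stdSimplex ℝ (Fin n))
    (h : (Δ : EReal) ≤ objective α vbar μ (priceMechanism v x)) :
    ∃ lam, IsLPFeasible α vbar μ v x lam Δ := by
  have hbar := hμ.1.trans hμ.2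
  have hslope : ∀ i, ∃ s : ℝ, ∀ a, Δ ≤ supportValue α vbar v x i a -
      s * (supportPoint vbar v a - μ) := by
    intro i
    refine exists_slope _ _ _ _ (fun a ha => ?_) fun a b ha hb =>
      segment_le_of_le_objective hα hμ hmono hv hx.1 h i ha.le hb
    -- A support point at `μ` is the left end of a segment to `vbar` when `μ < vbar`, and there the
    -- segment inequality reduces to the required bound.
    rcases hμ.2.lt_or_eq with hlt | rfl
    · have hlast : supportPoint vbar v (some (Fin.last n)) = vbar := levels_last
      have := segment_le_of_le_objective hα hμ hmono hv hx.1 h i ha.le (hlast.symm ▸ hlt)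
      rw [ha, hlast, sub_self, zero_mul, add_zero, mul_comm] at this
      exact le_of_mul_le_mul_left this (sub_pos.2 hlt)
    -- With `μ = vbar` no mass can lie below `vbar`. As all prices are strictly smaller, the payment
    -- has no jump at `vbar`, so the point mass there attains the left limit.
    · have hvlt : ∀ i, v i < μ := hdeg.resolve_left (lt_irrefl _)
      have hpos : 0 < μ := (hv ⟨0, hn⟩).1.trans_lt (hvlt ⟨0, hn⟩)
      obtain rfl : a = some (Fin.last n) := by
        cases a with
        | none => exact absurd ha hpos.ne
        | some j =>
          induction j using Fin.lastCases with
          | last => rfl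
          | cast j => exact absurd ((levels_castSucc j).symm.trans ha) (hvlt j).ne
      have hLi := levels_mem hbar hv i
      have hd := le_two_point_of_le_objective (fun i => (hv i).1) hx.1 h (a := μ) (b := μ)
        (s := 1) ⟨hbar, le_rfl⟩ ⟨hbar, le_rfl⟩ ⟨zero_le_one, le_rfl⟩ (by ring) hLi
      rw [Set.indicator_of_mem (by exact hLi.2),
        payment_priceMechanism (fun i => (hv i).1) hx.1] at hd
      simpa [supportValue, partialSum, Fin.le_last, Fin.castSucc_lt_last,
        fun i => (hvlt i).le] using hd
  choose lam hlam using hslope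
  exact ⟨lam, (isLPFeasible_iff hx).2 hlam⟩

theorem exists_isLPFeasible_iff {α μ Δ : ℝ} (hn : 0 < n) (hα : 0 ≤ α)
    (hμ : μ ∈ Set.Icc 0 vbar) (hmono : Monotone v) (hv : ∀ i, v i ∈ Set.Icc 0 vbar)
    (hdeg : μ < vbar ∨ ∀ i, v i < vbar) (hx : x ∈ stdSimplex ℝ (Fin n)) :
    (∃ lam, IsLPFeasible α vbar μ v x lam Δ) ↔
      (Δ : EReal) ≤ objective α vbar μ (priceMechanism v x) :=
  ⟨fun ⟨_, h⟩ => h.le_objective hα hmono hv,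
    exists_isLPFeasible_of_le_objective hn hα hμ hmono hv hdeg hx⟩

/-- Finiteness lets the objective itself serve as `Δ` in the linear program, so optimal `x`
correspond to attained optima. -/
theorem exists_objective_eq_coe {α μ : ℝ} (hα : 0 ≤ α)
    (hμ : μ ∈ Set.Icc 0 vbar) (hmono : Monotone v) (hv : ∀ i, v i ∈ Set.Icc 0 vbar)
    (hx : x ∈ stdSimplex ℝ (Fin n)) :
    ∃ r : ℝ, objective α vbar μ (priceMechanism v x) = r := by
  have hbar := hμ.1.trans hμ.2
  -- Flat lines at `-(α * vbar)`: payments are nonnegative and no competing price exceeds `vbar`.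
  have hfeas : IsLPFeasible α vbar μ v x (fun _ => 0) (-(α * vbar)) := by
    have hαv := mul_nonneg hα hbar
    have hP := fun j => partialSum_nonneg (x := x) (fun i => (hv i).1) hx.1 j
    refine ⟨hx.1, hx.2, fun i j _ => ?_, fun i j _ => ?_, fun i => ?_⟩
    · linarith [hP j]
    · linarith [hP j, mul_le_mul_of_nonneg_left (levels_mem hbar hv i).2 hα]
    · linarith
  have hmem : Measure.dirac μ ∈ meanAmbiguitySet vbar μ :=
    ⟨inferInstance, by simp [hμ.1, hμ.2], integral_dirac _ _⟩
  have hbot := ne_bot_of_le_ne_bot (EReal.coe_ne_bot _) (hfeas.le_objective hα hmono hv)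
  have htop : objective α vbar μ (priceMechanism v x) ≠ ⊤ :=
    ne_top_of_le_ne_top (EReal.coe_ne_top _)
      ((iInf₂_le (Measure.dirac μ) hmem).trans (iInf₂_le 0 ⟨le_rfl, hbar⟩))
  exact ⟨_, (EReal.coe_toReal htop hbot).symm⟩

end Dual

end RobustPricing

/-! ### Optimal values and optimal mechanisms -/

open RobustPricing in
theorem mainTheorem11 (n : ℕ) (hn : 0 < n) (α vbar μ : ℝ) (hα : α ∈ Set.Icc (0 : ℝ) 1)
    (hμ : μ ∈ Set.Icc 0 vbar) (v : Fin n → ℝ) (hv : Monotone v)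
    (hv_mem : ∀ i, v i ∈ Set.Icc 0 vbar)
    (hdeg : μ < vbar ∨ ∀ i, v i < vbar) :
    RobustPricing.optimalObjective α vbar μ v = RobustPricing.lpValue α vbar μ v ∧
    ∀ x ∈ stdSimplex ℝ (Fin n),
      (RobustPricing.objective α vbar μ (RobustPricing.priceMechanism v x) =
          RobustPricing.optimalObjective α vbar μ v ↔
        ∃ (lam : Fin (n + 1) → ℝ) (Δ : ℝ), RobustPricing.IsLPOptimal α vbar μ v x lam Δ) := by
  have hiff : ∀ {x : Fin n → ℝ} {Δ : ℝ}, x ∈ stdSimplex ℝ (Fin n) →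
      ((∃ lam, IsLPFeasible α vbar μ v x lam Δ) ↔
        (Δ : EReal) ≤ objective α vbar μ (priceMechanism v x)) := fun hx =>
    exists_isLPFeasible_iff hn hα.1 hμ hv hv_mem hdeg hx
  have hreal : ∀ {x : Fin n → ℝ}, x ∈ stdSimplex ℝ (Fin n) →
      ∃ r : ℝ, objective α vbar μ (priceMechanism v x) = r := fun hx =>
    exists_objective_eq_coe hα.1 hμ hv hv_mem hx
  have hle : ∀ {x : Fin n → ℝ}, x ∈ stdSimplex ℝ (Fin n) →
      objective α vbar μ (priceMechanism v x) ≤ optimalObjective α vbar μ v := fun {x} hx =>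
    le_iSup₂_of_le (priceMechanism v x) ⟨x, hx, rfl⟩ le_rfl
  refine ⟨le_antisymm ?_ ?_, fun x hx => ⟨fun h => ?_, ?_⟩⟩
  · refine iSup₂_le ?_
    rintro _ ⟨x, hx, rfl⟩
    obtain ⟨r, hr⟩ := hreal hx
    obtain ⟨lam, hlam⟩ := (hiff hx).2 hr.ge
    rw [hr]
    exact le_iSup_of_le x (le_iSup_of_le lam (le_iSup₂_of_le r hlam le_rfl))
  · refine iSup_le fun x => iSup_le fun lam => iSup₂_le fun Δ h => ?_
    have hx : x ∈ stdSimplex ℝ (Fin n) := ⟨h.nonneg, h.sum_eq_one⟩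
    exact ((hiff hx).1 ⟨lam, h⟩).trans (hle hx)
  · obtain ⟨r, hr⟩ := hreal hx
    obtain ⟨lam, hlam⟩ := (hiff hx).2 hr.ge
    refine ⟨lam, r, hlam, fun x' lam' Δ' h' => ?_⟩
    have hx' : x' ∈ stdSimplex ℝ (Fin n) := ⟨h'.nonneg, h'.sum_eq_one⟩
    have := ((hiff hx').1 ⟨lam', h'⟩).trans (hle hx')
    rwa [← h, hr, EReal.coe_le_coe_iff] at this
  · rintro ⟨lam, Δ, hfeas, hopt⟩
    refine le_antisymm (hle hx) (iSup₂_le ?_)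
    rintro _ ⟨x', hx', rfl⟩
    obtain ⟨r, hr⟩ := hreal hx'
    obtain ⟨lam', h'⟩ := (hiff hx').2 hr.ge
    rw [hr]
    exact (EReal.coe_le_coe_iff.2 (hopt _ _ _ h')).trans ((hiff hx).1 ⟨lam, hfeas⟩)
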